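/- Let $(X,d)$ be a compact metric space, $P(X)$ the set of its Borel probability measures, and $$W_1(\mu,\xi)=\inf_{\pi}\int d(x_1,x_2)\,d\pi(x_1,x_2),$$ the infimum being over the probability measures $\pi$ on $X\times X$ with marginals $\mu$ and $\xi$. Let $\phi:\mathbb R\to[-\infty,\infty]$ be proper (never $-\infty$, not identically $\infty$), convex and lower semicontinuous, and for $\mu,\nu\in P(X)$ let $$D_\phi(\mu\Vert\nu)=\int \phi\circ\frac{d\mu_c}{d\nu}\,d\nu+\phi'(\infty)\,\mu_s(X)\in(-\infty,\infty],\qquad \phi'(\infty)=\lim_{x\to\infty}\frac{\phi(x)}{x},$$ where $\mu=\mu_c+\mu_s$ with $\mu_c\ll\nu$, $\mu_s\perp\nu$ is the Lebesgue decomposition of $\mu$ with respect to $\nu$, and $0\cdot\infty=0$. For real $\lambda,\alpha>0$ define $$D_{\phi,\lambda,\alpha}(\mu\Vert\nu)=\inf_{\xi\in P(X)}\left\{D_\phi(\xi\Vert\nu)+\lambda W_1(\mu,\xi)^\alpha\right\}.$$ Then for every $\nu\in P(X)$ and every real $\alpha>0$: 1. For all $\mu\in P(X)$ and $\lambda>0$,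 the infimum defining $D_{\phi,\lambda,\alpha}(\mu\Vert\nu)$ is attained by some $\xi\in P(X)$. 2. For all $\mu\in P(X)$, $D_\phi(\mu\Vert\nu)=\sup_{\lambda>0}D_{\phi,\lambda,\alpha}(\mu\Vert\nu)=\lim_{\lambda\to\infty}D_{\phi,\lambda,\alpha}(\mu\Vert\nu)$. 3. Suppose in addition that $\phi(1)<\infty$ (in particular this holds if $\phi(1)=0$). Then for every $\lambda>0$ the function $F=D_{\phi,\lambda,\alpha}(\cdot\Vert\nu)$ is real-valued on $P(X)$, and: - if $\alpha<1$, then $|F(\mu_1)-F(\mu_2)|\le\lambda W_1(\mu_1,\mu_2)^\alpha$ for all $\mu_1,\mu_2\in P(X)$; - if $\alpha=1$, then $|F(\mu_1)-F(\mu_2)|\le\lambda W_1(\mu_1,\mu_2)$ for all $\mu_1,\mu_2\in P(X)$; - if $\alpha>1$, then there is a constant $C\ge 0$ with $|F(\mu_1)-F(\mu_2)|\le C\,W_1(\mu_1,\mu_2)$ for all $\mu_1,\mu_2\in P(X)$. -/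

import Mathlib

open MeasureTheory Filter Topology

noncomputable section

/-- A function `φ : ℝ → [-∞, ∞]` is proper if it is not identically `∞` and never takes the
value `-∞`. -/
def IsProperFn (φ : ℝ → EReal) : Prop :=
  (∃ x, φ x < ⊤) ∧ ∀ x, ⊥ < φ x

/-- Convexity of an extended-real-valued function on `ℝ` (with the convention `0 * ∞ = 0`, and used
for functions that never take the value `-∞`). -/
def IsConvexFn (φ : ℝ → EReal) : Prop :=
  ∀ x y a b : ℝ, 0 ≤ a → 0 ≤ b → a + b = 1 →
    φ (a * x + b * y) ≤ (a : EReal) * φ x + (b : EReal) * φ y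

/-- The slope at infinity `φ'(∞) = lim_{x → ∞} φ(x) / x`, an extended real number. For proper convex
`φ` the limit exists, so it equals the lower limit used here. -/
def slopeAtTop (φ : ℝ → EReal) : EReal :=
  liminf (fun x : ℝ => φ x / (x : EReal)) atTop

/-- The integral `∫ g dν ∈ [-∞, ∞]` of an extended-real-valued function: the integral of the
positive part minus the integral of the negative part. -/
def erealIntegral {X : Type*} [MeasurableSpace X] (ν : Measure X) (g : X → EReal) : EReal :=
  ((∫⁻ x, (g x).toENNReal ∂ν : ENNReal) : EReal) - ((∫⁻ x, (-g x).toENNReal ∂ν : ENNReal) : EReal)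

/-- The `f`-divergence `D_φ(μ ‖ ν) = ∫ φ ∘ (dμ_c / dν) dν + φ'(∞) μ_s(X)`, where `μ = μ_c + μ_s` is
the Lebesgue decomposition of `μ` with respect to `ν`. Since `μ` is a nonnegative measure, the
negative part of `μ_s` vanishes. -/
def fDivergence {X : Type*} [MeasurableSpace X] (φ : ℝ → EReal) (μ ν : ProbabilityMeasure X) :
    EReal :=
  erealIntegral (ν : Measure X)
      (fun x => φ (((μ : Measure X).rnDeriv (ν : Measure X) x).toReal)) +
    slopeAtTop φ * (((μ : Measure X).singularPart (ν : Measure X) Set.univ : ENNReal) : EReal)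

/-- The couplings of `μ` and `ν`: the probability measures on `X × X` with marginals `μ`, `ν`. -/
def couplings {X : Type*} [MeasurableSpace X] (μ ν : ProbabilityMeasure X) :
    Set (ProbabilityMeasure (X × X)) :=
  {π | (π : Measure (X × X)).map Prod.fst = (μ : Measure X) ∧
    (π : Measure (X × X)).map Prod.snd = (ν : Measure X)}

/-- The Wasserstein-1 distance of two probability measures. (On a compact space the distance is
bounded, so every integral here is finite.) -/
def wasserstein1 {X : Type*} [MetricSpace X] [MeasurableSpace X] (μ ν : ProbabilityMeasure X) : ℝ :=
  ⨅ π : couplings μ ν, ∫ z, dist z.1 z.2 ∂(π.1 : Measure (X × X))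

/-- The quantity `D_φ(ξ ‖ ν) + l * W₁(μ, ξ) ^ α` that is minimized over `ξ`. -/
def moreauYosidaObjective {X : Type*} [MetricSpace X] [MeasurableSpace X] (φ : ℝ → EReal)
    (l α : ℝ) (μ ν ξ : ProbabilityMeasure X) : EReal :=
  fDivergence φ ξ ν + ((l * wasserstein1 μ ξ ^ α : ℝ) : EReal)

/-- The Moreau-Yosida approximation `D_{φ,l,α}(μ ‖ ν)` of index `l` and order `α` of `D_φ(· ‖ ν)`
with respect to `W₁`. -/
def moreauYosidaDivergence {X : Type*} [MetricSpace X] [MeasurableSpace X] (φ : ℝ → EReal)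
    (l α : ℝ) (μ ν : ProbabilityMeasure X) : EReal :=
  ⨅ ξ : ProbabilityMeasure X, moreauYosidaObjective φ l α μ ν ξ

/-- `F` is finite everywhere and Hölder continuous with respect to `W₁` with exponent `r` and
constant `C` (for `r = 1`: Lipschitz continuous with constant `C`). -/
def IsHolderW1 {X : Type*} [MetricSpace X] [MeasurableSpace X] (C r : ℝ)
    (F : ProbabilityMeasure X → EReal) : Prop :=
  (∀ μ, F μ ≠ ⊤ ∧ F μ ≠ ⊥) ∧
    ∀ μ₁ μ₂, |(F μ₁).toReal - (F μ₂).toReal| ≤ C * wasserstein1 μ₁ μ₂ ^ r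

end

/-! A convex lower semicontinuous `φ` is the supremum of its affine minorants `t ↦ a + b * t`.
Writing `ν` and `ξ` in terms of densities with respect to a common measure, `D_φ(ξ‖ν)` becomes the
integral of the support function of the set of pairs `(a, b)` evaluated at those densities, the
recession slope `φ'(∞)` being the value of that support function at `(0, 1)`. Choosing the affine
minorant continuously in the point of `X` exchanges supremum and integral, so `D_φ(·‖ν)` is a
supremum of weakly continuous affine functionals of `ξ`, hence weakly lower semicontinuous and
bounded below.

The rest is Moreau–Yosida regularization on the weakly compact space of probability measures: `W₁`
is weakly lower semicontinuous, convergence in `W₁` implies weak convergence, and the modulus of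
continuity of `t ↦ l * t ^ α` on `[0, diam X]` passes to the infimum.
-/

section AffineMinorants

/-- The affine minorants of `φ`, the function `t ↦ a + b * t` being encoded as the pair `(a, b)`. -/
def affineMinorants (φ : ℝ → EReal) : Set (ℝ × ℝ) :=
  {p | ∀ t : ℝ, ((p.1 + p.2 * t : ℝ) : EReal) ≤ φ t}

variable {φ : ℝ → EReal}

lemma mem_affineMinorants_iff_epigraph {p : ℝ × ℝ} :
    p ∈ affineMinorants φ ↔ ∀ t y : ℝ, φ t ≤ y → p.1 + p.2 * t ≤ y := by
  refine ⟨fun hp t y hy => EReal.coe_le_coe_iff.1 ((hp t).trans hy), fun h t => ?_⟩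
  exact EReal.le_of_forall_lt_iff_le.1 fun y hy => EReal.coe_le_coe_iff.2 (h t y hy.le)

lemma convex_affineMinorants (φ : ℝ → EReal) : Convex ℝ (affineMinorants φ) := by
  intro p hp q hq a b ha hb hab
  rw [mem_affineMinorants_iff_epigraph] at hp hq ⊢
  intro t y hty
  calc a * p.1 + b * q.1 + (a * p.2 + b * q.2) * t
      = a * (p.1 + p.2 * t) + b * (q.1 + q.2 * t) := by ring
    _ ≤ a * y + b * y := by gcongr; exacts [hp t y hty, hq t y hty]
    _ = y := by rw [← add_mul, hab, one_mul]

lemma IsConvexFn.convex_epigraph (hφ : IsConvexFn φ) :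
    Convex ℝ {p : ℝ × ℝ | φ p.1 ≤ (p.2 : EReal)} := by
  intro p hp q hq a b ha hb hab
  calc φ (a * p.1 + b * q.1) ≤ a * φ p.1 + b * φ q.1 := hφ p.1 q.1 a b ha hb hab
    _ ≤ a * (p.2 : EReal) + b * (q.2 : EReal) :=
      add_le_add (mul_le_mul_of_nonneg_left hp (EReal.coe_nonneg.2 ha))
        (mul_le_mul_of_nonneg_left hq (EReal.coe_nonneg.2 hb))
    _ = ((a * p.2 + b * q.2 : ℝ) : EReal) := by norm_cast

lemma isClosed_epigraph_real (hφ : LowerSemicontinuous φ) :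
    IsClosed {p : ℝ × ℝ | φ p.1 ≤ (p.2 : EReal)} :=
  hφ.isClosed_epigraph.preimage
    (continuous_fst.prodMk (continuous_coe_real_ereal.comp continuous_snd))

lemma exists_line_separating_epigraph (hφ_proper : IsProperFn φ) (hφ_convex : IsConvexFn φ)
    (hφ_lsc : LowerSemicontinuous φ) {t c : ℝ} (hc : (c : EReal) < φ t) :
    ∃ p q u : ℝ, 0 ≤ q ∧ p * t + q * c < u ∧
      ∀ x y : ℝ, φ x ≤ (y : EReal) → u < p * x + q * y := by
  obtain ⟨f, u, hu, hf⟩ := geometric_hahn_banach_point_closed hφ_convex.convex_epigraph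
    (isClosed_epigraph_real hφ_lsc)
    (show (t, c) ∉ {p : ℝ × ℝ | φ p.1 ≤ (p.2 : EReal)} from not_le.2 hc)
  have hlin (x y : ℝ) : f (x, y) = f (1, 0) * x + f (0, 1) * y := by
    have : ((x, y) : ℝ × ℝ) = x • (1, 0) + y • (0, 1) := by simp
    rw [this, map_add, map_smul, map_smul, smul_eq_mul, smul_eq_mul, mul_comm x, mul_comm y]
  have hsep (x y : ℝ) (hxy : φ x ≤ (y : EReal)) : u < f (1, 0) * x + f (0, 1) * y :=
    hlin x y ▸ hf _ hxy
  refine ⟨f (1, 0), f (0, 1), u, ?_, hlin t c ▸ hu, hsep⟩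
  obtain ⟨x₀, hx₀⟩ := hφ_proper.1
  obtain ⟨y₀, hy₀, -⟩ := EReal.lt_iff_exists_real_btwn.1 hx₀
  -- The epigraph contains the upward ray from `(x₀, y₀)`, on which a negative slope is unbounded.
  by_contra! hq
  set y := max y₀ ((u - f (1, 0) * x₀) / f (0, 1))
  have hy : f (0, 1) * y ≤ u - f (1, 0) * x₀ := by
    rw [mul_comm, ← div_le_iff_of_neg hq]
    exact le_max_right _ _
  have := hsep x₀ y (hy₀.le.trans (EReal.coe_le_coe_iff.2 (le_max_left _ _)))
  linarith

lemma mem_affineMinorants_of_line {p q u : ℝ} (hq : 0 < q)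
    (h : ∀ x y : ℝ, φ x ≤ (y : EReal) → u < p * x + q * y) :
    (u / q, -(p / q)) ∈ affineMinorants φ := by
  refine mem_affineMinorants_iff_epigraph.2 fun x y hxy => ?_
  have hline : u / q + -(p / q) * x = (u - p * x) / q := by ring
  rw [hline, div_le_iff₀ hq]
  linarith [h x y hxy]

lemma affineMinorants_nonempty (hφ_proper : IsProperFn φ) (hφ_convex : IsConvexFn φ)
    (hφ_lsc : LowerSemicontinuous φ) : (affineMinorants φ).Nonempty := by
  obtain ⟨x₀, hx₀⟩ := hφ_proper.1
  obtain ⟨y₀, hy₀, -⟩ := EReal.lt_iff_exists_real_btwn.1 hx₀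
  obtain ⟨c, -, hc⟩ := EReal.lt_iff_exists_real_btwn.1 (hφ_proper.2 x₀)
  obtain ⟨p, q, u, hq, hbelow, habove⟩ :=
    exists_line_separating_epigraph hφ_proper hφ_convex hφ_lsc hc
  rcases hq.eq_or_lt with rfl | hq
  · linarith [habove x₀ y₀ hy₀.le]
  · exact ⟨_, mem_affineMinorants_of_line hq habove⟩

lemma add_smul_mem_affineMinorants {k d : ℝ × ℝ} (hk : k ∈ affineMinorants φ)
    (hd : ∀ x y : ℝ, φ x ≤ (y : EReal) → d.1 + d.2 * x ≤ 0) {s : ℝ} (hs : 0 ≤ s) :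
    k + s • d ∈ affineMinorants φ := by
  rw [mem_affineMinorants_iff_epigraph] at hk ⊢
  intro x y hxy
  calc k.1 + s * d.1 + (k.2 + s * d.2) * x = k.1 + k.2 * x + s * (d.1 + d.2 * x) := by ring
    _ ≤ y := by linarith [hk x y hxy, mul_nonpos_of_nonneg_of_nonpos hs (hd x y hxy)]

lemma exists_mem_affineMinorants_lt (hφ_proper : IsProperFn φ) (hφ_convex : IsConvexFn φ)
    (hφ_lsc : LowerSemicontinuous φ) {t c : ℝ} (hc : (c : EReal) < φ t) :
    ∃ p ∈ affineMinorants φ, c < p.1 + p.2 * t := by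
  obtain ⟨p, q, u, hq, hbelow, habove⟩ :=
    exists_line_separating_epigraph hφ_proper hφ_convex hφ_lsc hc
  rcases hq.eq_or_lt with rfl | hq
  -- A vertical line is a recession direction of the set of affine minorants.
  · obtain ⟨k, hk⟩ := affineMinorants_nonempty hφ_proper hφ_convex hφ_lsc
    have hpos : 0 < u - p * t := by linarith
    obtain ⟨n, hn⟩ := exists_nat_gt ((c - (k.1 + k.2 * t)) / (u - p * t))
    rw [div_lt_iff₀ hpos] at hn
    refine ⟨k + (n : ℝ) • (u, -p), add_smul_mem_affineMinorants hk (fun x y hxy => ?_)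
      n.cast_nonneg, ?_⟩
    · linarith [habove x y hxy]
    · simp only [Prod.fst_add, Prod.snd_add, Prod.smul_fst, Prod.smul_snd, smul_eq_mul]
      linarith
  · refine ⟨_, mem_affineMinorants_of_line hq habove, ?_⟩
    have hline : u / q + -(p / q) * t = (u - p * t) / q := by ring
    rw [hline, lt_div_iff₀ hq]
    linarith

lemma le_slopeAtTop {p : ℝ × ℝ} (hp : p ∈ affineMinorants φ) :
    (p.2 : EReal) ≤ slopeAtTop φ := by
  have hlim : Tendsto (fun x : ℝ => ((p.1 / x + p.2 : ℝ) : EReal)) atTop (𝓝 (p.2 : EReal)) := by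
    refine (continuous_coe_real_ereal.tendsto _).comp ?_
    simpa using ((tendsto_const_nhds (x := p.1)).div_atTop tendsto_id).add_const p.2
  rw [← hlim.liminf_eq, slopeAtTop]
  refine liminf_le_liminf ?_
  filter_upwards [eventually_gt_atTop (0 : ℝ)] with x hx
  have hmul : (p.1 / x + p.2) * x = p.1 + p.2 * x := by field_simp
  rw [EReal.le_div_iff_mul_le (EReal.coe_pos.2 hx) (EReal.coe_ne_top x), ← EReal.coe_mul, hmul]
  exact hp x

lemma exists_mem_affineMinorants_le_snd (hne : (affineMinorants φ).Nonempty) {c : ℝ}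
    (hc : (c : EReal) < slopeAtTop φ) : ∃ p ∈ affineMinorants φ, c ≤ p.2 := by
  obtain ⟨k, hk⟩ := hne
  rcases le_or_gt c k.2 with hkc | hkc
  · exact ⟨k, hk, hkc⟩
  obtain ⟨x₀, hx₀⟩ := eventually_atTop.1 (eventually_lt_of_lt_liminf hc)
  set x₁ := max x₀ 1
  have hx₁ : 0 < x₁ := lt_max_of_lt_right one_pos
  -- Beyond `x₁` the line `t ↦ c * t` lies below `φ`; before `x₁` the given minorant takes over.
  refine ⟨(min 0 (k.1 + (k.2 - c) * x₁), c), fun x => ?_, le_rfl⟩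
  rcases le_total x₁ x with hx | hx
  · have hcx := (hx₀ x ((le_max_left _ _).trans hx)).le
    rw [EReal.le_div_iff_mul_le (EReal.coe_pos.2 (hx₁.trans_le hx)) (EReal.coe_ne_top x),
      ← EReal.coe_mul] at hcx
    exact (EReal.coe_le_coe_iff.2 (by simp)).trans hcx
  · refine (EReal.coe_le_coe_iff.2 ?_).trans (hk x)
    have hmin : min 0 (k.1 + (k.2 - c) * x₁) ≤ k.1 + (k.2 - c) * x₁ := min_le_right _ _
    have hslope : (k.2 - c) * x₁ ≤ (k.2 - c) * x :=
      mul_le_mul_of_nonpos_left hx (sub_nonpos.2 hkc.le)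
    dsimp only
    linarith

end AffineMinorants

section SupportFunction

variable {E : Type*} [AddCommGroup E] [Module ℝ E] [TopologicalSpace E] {K : Set E}

/-- The support function `ℓ ↦ sup_{p ∈ K} ℓ p` of a set `K`, with values in `[-∞, ∞]`. -/
noncomputable def supportFunction (K : Set E) (ℓ : StrongDual ℝ E) : EReal :=
  ⨆ p ∈ K, ((ℓ p : ℝ) : EReal)

lemma le_supportFunction {p : E} (hp : p ∈ K) (ℓ : StrongDual ℝ E) :
    ((ℓ p : ℝ) : EReal) ≤ supportFunction K ℓ :=
  le_iSup₂_of_le p hp le_rfl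

lemma supportFunction_eq_iSup_of_dense {k : ℕ → E} (hk : ∀ n, k n ∈ K)
    (hdense : K ⊆ closure (Set.range k)) (ℓ : StrongDual ℝ E) :
    supportFunction K ℓ = ⨆ n, ((ℓ (k n) : ℝ) : EReal) := by
  refine le_antisymm (iSup₂_le fun p hp => ?_) (iSup_le fun n => le_supportFunction (hk n) ℓ)
  have hle (n : ℕ) : ((ℓ (k n) : ℝ) : EReal) ≤ ⨆ n, ((ℓ (k n) : ℝ) : EReal) :=
    le_iSup (fun n => ((ℓ (k n) : ℝ) : EReal)) n
  have hclosed : IsClosed {q : E | ((ℓ q : ℝ) : EReal) ≤ ⨆ n, ((ℓ (k n) : ℝ) : EReal)} :=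
    isClosed_le (continuous_coe_real_ereal.comp ℓ.continuous) continuous_const
  exact closure_minimal (Set.range_subset_iff.2 hle) hclosed (hdense hp)

open ContinuousLinearMap in
lemma supportFunction_affineMinorants_fst_add_smul_snd {φ : ℝ → EReal} (hφ_proper : IsProperFn φ)
    (hφ_convex : IsConvexFn φ) (hφ_lsc : LowerSemicontinuous φ) (t : ℝ) :
    supportFunction (affineMinorants φ) (fst ℝ ℝ ℝ + t • snd ℝ ℝ ℝ) = φ t := by
  have hval (p : ℝ × ℝ) : (fst ℝ ℝ ℝ + t • snd ℝ ℝ ℝ) p = p.1 + p.2 * t := by simp [mul_comm]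
  refine le_antisymm (iSup₂_le fun p hp => hval p ▸ hp t) ?_
  refine EReal.ge_of_forall_gt_iff_ge.1 fun c hc => ?_
  obtain ⟨p, hp, hcp⟩ := exists_mem_affineMinorants_lt hφ_proper hφ_convex hφ_lsc hc
  exact (EReal.coe_le_coe_iff.2 (hval p ▸ hcp.le)).trans (le_supportFunction hp _)

lemma supportFunction_affineMinorants_snd {φ : ℝ → EReal} (hne : (affineMinorants φ).Nonempty) :
    supportFunction (affineMinorants φ) (ContinuousLinearMap.snd ℝ ℝ ℝ) = slopeAtTop φ := by
  refine le_antisymm (iSup₂_le fun p hp => le_slopeAtTop hp) ?_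
  refine EReal.ge_of_forall_gt_iff_ge.1 fun c hc => ?_
  obtain ⟨p, hp, hcp⟩ := exists_mem_affineMinorants_le_snd hne hc
  exact (EReal.coe_le_coe_iff.2 hcp).trans
    (le_supportFunction hp (ContinuousLinearMap.snd ℝ ℝ ℝ))

end SupportFunction

section ErealIntegral

variable {X : Type*} [MeasurableSpace X] {μ : Measure X} {g h : X → EReal}

lemma erealIntegral_mono (hgh : ∀ x, g x ≤ h x) : erealIntegral μ g ≤ erealIntegral μ h := by
  refine EReal.sub_le_sub ?_ ?_ <;> refine EReal.coe_ennreal_le_coe_ennreal_iff.2 ?_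
  · exact lintegral_mono fun x => EReal.toENNReal_le_toENNReal (hgh x)
  · exact lintegral_mono fun x => EReal.toENNReal_le_toENNReal (EReal.neg_le_neg_iff.2 (hgh x))

lemma erealIntegral_congr_ae (hgh : g =ᵐ[μ] h) : erealIntegral μ g = erealIntegral μ h := by
  have hpos := lintegral_congr_ae (hgh.mono fun x hx => congrArg EReal.toENNReal hx)
  have hneg := lintegral_congr_ae (hgh.mono fun x hx => congrArg (fun y => (-y).toENNReal) hx)
  rw [erealIntegral, hpos, hneg, erealIntegral]

lemma erealIntegral_coe {u : X → ℝ} (hu : Integrable u μ) :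
    erealIntegral μ (fun x => (u x : EReal)) = ((∫ x, u x ∂μ : ℝ) : EReal) := by
  have hneg : ∫⁻ x, ENNReal.ofReal (-u x) ∂μ ≠ ⊤ := hu.neg.lintegral_lt_top.ne
  rw [integral_eq_lintegral_pos_part_sub_lintegral_neg_part hu, erealIntegral, EReal.coe_sub,
    EReal.coe_ennreal_toReal hu.lintegral_lt_top.ne, EReal.coe_ennreal_toReal hneg]
  rfl

lemma erealIntegral_const (c : EReal) :
    erealIntegral μ (fun _ => c) = c * (μ Set.univ : EReal) := by
  rw [erealIntegral, lintegral_const, lintegral_const]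
  rcases le_total 0 c with hc | hc
  · simp [EReal.toENNReal_of_nonpos (EReal.neg_le_zero.2 hc), EReal.coe_toENNReal hc]
  · simp [EReal.toENNReal_of_nonpos hc, EReal.coe_toENNReal (EReal.neg_nonneg.2 hc)]

lemma erealIntegral_add_measure (μ ν : Measure X) (g : X → EReal) :
    erealIntegral (μ + ν) g = erealIntegral μ g + erealIntegral ν g := by
  simp only [erealIntegral, lintegral_add_measure, EReal.coe_ennreal_add, sub_eq_add_neg]
  rw [EReal.neg_add (Or.inl (EReal.coe_ennreal_ne_bot _)) (Or.inr (EReal.coe_ennreal_ne_bot _)),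
    sub_eq_add_neg, add_add_add_comm]

lemma tendsto_erealIntegral_of_monotone {f : ℕ → X → EReal} (hf : ∀ n, Measurable (f n))
    (hmono : ∀ x, Monotone fun n => f n x)
    (hlim : ∀ x, Tendsto (fun n => f n x) atTop (𝓝 (g x)))
    (hfin : ∫⁻ x, (-f 0 x).toENNReal ∂μ ≠ ⊤) :
    Tendsto (fun n => erealIntegral μ (f n)) atTop (𝓝 (erealIntegral μ g)) := by
  have hpos := lintegral_tendsto_of_tendsto_of_monotone (μ := μ)
    (f := fun n x => (f n x).toENNReal) (F := fun x => (g x).toENNReal)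
    (fun n => (hf n).ereal_toENNReal.aemeasurable)
    (ae_of_all _ fun x m n hmn => EReal.toENNReal_le_toENNReal (hmono x hmn))
    (ae_of_all _ fun x => (EReal.continuous_toENNReal.tendsto _).comp (hlim x))
  have hneg := lintegral_tendsto_of_tendsto_of_antitone (μ := μ)
    (f := fun n x => (-f n x).toENNReal) (F := fun x => (-g x).toENNReal)
    (fun n => (hf n).neg.ereal_toENNReal.aemeasurable)
    (ae_of_all _ fun x m n hmn =>
      EReal.toENNReal_le_toENNReal (EReal.neg_le_neg_iff.2 (hmono x hmn))) hfin
    (ae_of_all _ fun x => (EReal.continuous_toENNReal.tendsto _).comp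
      ((continuous_neg.tendsto _).comp (hlim x)))
  have hneg_ne_top : ∫⁻ x, (-g x).toENNReal ∂μ ≠ ⊤ :=
    ne_top_of_le_ne_top hfin <| lintegral_mono fun x => EReal.toENNReal_le_toENNReal <|
      EReal.neg_le_neg_iff.2 ((hmono x).ge_of_tendsto (hlim x) 0)
  simp only [erealIntegral, sub_eq_add_neg]
  refine (EReal.continuousAt_add (Or.inr ?_)
    (Or.inl (EReal.coe_ennreal_ne_bot _))).tendsto.comp <|
    ((continuous_coe_ennreal_ereal.tendsto _).comp hpos).prodMk_nhds <|
      (continuous_neg.tendsto _).comp ((continuous_coe_ennreal_ereal.tendsto _).comp hneg)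
  simpa [EReal.neg_eq_bot_iff] using hneg_ne_top

end ErealIntegral

section ContinuousSelection

open scoped BoundedContinuousFunction

lemma exists_seq_mem_dense {E : Type*} [TopologicalSpace E] [SecondCountableTopology E] {K : Set E}
    (hK : K.Nonempty) : ∃ k : ℕ → E, (∀ n, k n ∈ K) ∧ K ⊆ closure (Set.range k) := by
  have := hK.to_subtype
  refine ⟨fun n => TopologicalSpace.denseSeq K n, fun n => Subtype.coe_prop _, fun p hp => ?_⟩
  rw [Set.range_comp']
  exact image_closure_subset_closure_image continuous_subtype_val
    ⟨⟨p, hp⟩, TopologicalSpace.denseRange_denseSeq K _, rfl⟩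

variable {X : Type*} [TopologicalSpace X] [MeasurableSpace X]
  {E : Type*} [NormedAddCommGroup E] [NormedSpace ℝ E] {m : Measure X} {K : Set E} {g g' : X → E}

lemma exists_continuous_seq_tendsto_indicator [NormalSpace X] [BorelSpace X] (m : Measure X)
    [IsFiniteMeasure m] [m.WeaklyRegular] {A : Set X} (hA : MeasurableSet A) :
    ∃ h : ℕ → C(X, ℝ), (∀ n x, h n x ∈ Set.Icc (0 : ℝ) 1) ∧
      ∀ᵐ x ∂m, Tendsto (fun n => h n x) atTop (𝓝 (A.indicator 1 x)) := by
  have hint : Integrable (A.indicator (1 : X → ℝ)) m := (integrable_const 1).indicator hA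
  choose f hf hfi using fun n : ℕ => hint.exists_boundedContinuous_lintegral_sub_le
    (ε := ((n : ENNReal) + 1)⁻¹) (by simp)
  have hmeas : TendstoInMeasure m (fun n x => f n x) atTop (A.indicator (1 : X → ℝ)) := by
    refine tendstoInMeasure_of_tendsto_eLpNorm one_ne_zero
      (fun n => (hfi n).aestronglyMeasurable) hint.aestronglyMeasurable ?_
    refine tendsto_of_tendsto_of_tendsto_of_le_of_le tendsto_const_nhds
      (ENNReal.tendsto_inv_nat_nhds_zero.comp (tendsto_add_atTop_nat 1)) (fun n => zero_le)
      fun n => ?_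
    rw [eLpNorm_sub_comm, eLpNorm_one_eq_lintegral_enorm]
    simpa using hf n
  obtain ⟨ns, -, hns⟩ := hmeas.exists_seq_tendsto_ae
  refine ⟨fun n => ⟨fun x => Set.projIcc 0 1 zero_le_one (f (ns n) x), by fun_prop⟩,
    fun n x => Subtype.coe_prop _, ?_⟩
  filter_upwards [hns] with x hx
  have hcont : Continuous fun y : ℝ => (Set.projIcc 0 1 zero_le_one y : ℝ) := by fun_prop
  have hproj : (Set.projIcc 0 1 zero_le_one (A.indicator (1 : X → ℝ) x) : ℝ) =
      A.indicator 1 x := by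
    by_cases hxA : x ∈ A <;> simp [hxA]
  exact hproj ▸ (hcont.tendsto _).comp hx

/-- `g` is a strongly measurable `K`-valued function that is, `m`-almost everywhere, the pointwise
limit of a sequence of continuous `K`-valued functions. For convex `K` such functions can be glued
along measurable sets, so they serve as a substitute for Lusin's theorem with constraints. -/
structure IsContinuousLimit (m : Measure X) (K : Set E) (g : X → E) : Prop where
  stronglyMeasurable : StronglyMeasurable g
  mem : ∀ x, g x ∈ K
  exists_tendsto : ∃ w : ℕ → C(X, E), (∀ n x, w n x ∈ K) ∧
    ∀ᵐ x ∂m, Tendsto (fun n => w n x) atTop (𝓝 (g x))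

omit [NormedSpace ℝ E] in
lemma isContinuousLimit_const (m : Measure X) {p : E} (hp : p ∈ K) :
    IsContinuousLimit m K fun _ => p where
  stronglyMeasurable := stronglyMeasurable_const
  mem _ := hp
  exists_tendsto :=
    ⟨fun _ => .const X p, fun _ _ => hp, ae_of_all _ fun _ => tendsto_const_nhds⟩

open scoped Classical in
lemma IsContinuousLimit.piecewise [NormalSpace X] [BorelSpace X] [IsFiniteMeasure m]
    [m.WeaklyRegular] (hK : Convex ℝ K) (hg : IsContinuousLimit m K g)
    (hg' : IsContinuousLimit m K g') {A : Set X} (hA : MeasurableSet A) :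
    IsContinuousLimit m K (A.piecewise g g') where
  stronglyMeasurable := hg.stronglyMeasurable.piecewise hA hg'.stronglyMeasurable
  mem x := by by_cases hx : x ∈ A <;> simp [hx, hg.mem, hg'.mem]
  exists_tendsto := by
    obtain ⟨w, hwK, hw⟩ := hg.exists_tendsto
    obtain ⟨w', hwK', hw'⟩ := hg'.exists_tendsto
    obtain ⟨h, hh, hhA⟩ := exists_continuous_seq_tendsto_indicator m hA
    refine ⟨fun n => ⟨fun x => h n x • w n x + (1 - h n x) • w' n x, by fun_prop⟩,
      fun n x => hK (hwK n x) (hwK' n x) (hh n x).1 (sub_nonneg.2 (hh n x).2) (by ring), ?_⟩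
    filter_upwards [hw, hw', hhA] with x hx hx' hxA
    have hpiece : A.piecewise g g' x =
        A.indicator (1 : X → ℝ) x • g x + (1 - A.indicator (1 : X → ℝ) x) • g' x := by
      by_cases hxA : x ∈ A <;> simp [hxA]
    exact hpiece ▸ (hxA.smul hx).add ((hxA.const_sub 1).smul hx')

variable {L : X → StrongDual ℝ E}

omit [TopologicalSpace X] in
lemma stronglyMeasurable_dual_apply (hL : StronglyMeasurable L)
    (hg : StronglyMeasurable g) : StronglyMeasurable fun x => L x (g x) :=
  isBoundedBilinearMap_apply.continuous.comp_stronglyMeasurable (hL.prodMk hg)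

lemma exists_isContinuousLimit_apply_eq_partialSups [NormalSpace X] [BorelSpace X]
    [IsFiniteMeasure m] [m.WeaklyRegular] (hK : Convex ℝ K) (hL : StronglyMeasurable L)
    {k : ℕ → E} {N : ℕ} (hk : ∀ n ≤ N, k n ∈ K) :
    ∃ g, IsContinuousLimit m K g ∧
      ∀ x, ((L x (g x) : ℝ) : EReal) = partialSups (fun n => ((L x (k n) : ℝ) : EReal)) N := by
  induction N with
  | zero => exact ⟨_, isContinuousLimit_const m (hk 0 le_rfl), fun x => by simp⟩
  | succ N ih =>
    obtain ⟨g, hg, hgN⟩ := ih fun n hn => hk n (hn.trans N.le_succ)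
    have hconst := isContinuousLimit_const m (hk (N + 1) le_rfl)
    have hA : MeasurableSet {x | L x (g x) < L x (k (N + 1))} :=
      (stronglyMeasurable_dual_apply hL hg.stronglyMeasurable).measurableSet_lt
        (stronglyMeasurable_dual_apply hL stronglyMeasurable_const)
    classical
    refine ⟨_, hconst.piecewise hK hg hA, fun x => ?_⟩
    rw [partialSups_add_one, ← hgN x]
    by_cases hx : L x (g x) < L x (k (N + 1))
    · rw [Set.piecewise_eq_of_mem _ _ _ (by exact hx), sup_eq_right.2 (EReal.coe_le_coe hx.le)]
    · rw [Set.piecewise_eq_of_notMem _ _ _ (by exact hx),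
        sup_eq_left.2 (EReal.coe_le_coe (not_lt.1 hx))]

variable [SecondCountableTopology E]

lemma IsContinuousLimit.exists_lt_integral_apply [BorelSpace X] (hg : IsContinuousLimit m K g)
    (hK : Bornology.IsBounded K) (hL : Integrable L m) {c : ℝ}
    (hc : c < ∫ x, L x (g x) ∂m) :
    ∃ w : X →ᵇ E, (∀ x, w x ∈ K) ∧ c < ∫ x, L x (w x) ∂m := by
  obtain ⟨w, hwK, hw⟩ := hg.exists_tendsto
  obtain ⟨C, hC⟩ := hK.exists_norm_le
  have hlim : Tendsto (fun n => ∫ x, L x (w n x) ∂m) atTop (𝓝 (∫ x, L x (g x) ∂m)) := by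
    refine tendsto_integral_of_dominated_convergence (fun x => ‖L x‖ * C) (fun n => ?_)
      (hL.norm.mul_const C) (fun n => ae_of_all _ fun x => ?_) ?_
    · exact isBoundedBilinearMap_apply.continuous.comp_aestronglyMeasurable
        (hL.1.prodMk (w n).continuous.aestronglyMeasurable)
    · exact (L x).le_opNorm_of_le (hC _ (hwK n x))
    · filter_upwards [hw] with x hx using ((L x).continuous.tendsto _).comp hx
  obtain ⟨n, hn⟩ := (hlim.eventually (lt_mem_nhds hc)).exists
  exact ⟨.ofNormedAddCommGroup (w n) (w n).continuous C fun x => hC _ (hwK n x), hwK n, hn⟩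

omit [TopologicalSpace X] [SecondCountableTopology E] in
lemma integrable_dual_apply (hL : Integrable L m) (hg : AEStronglyMeasurable g m) {C : ℝ}
    (hC : ∀ x, ‖g x‖ ≤ C) : Integrable (fun x => L x (g x)) m :=
  (hL.norm.mul_const C).mono'
    (isBoundedBilinearMap_apply.continuous.comp_aestronglyMeasurable (hL.1.prodMk hg))
    (ae_of_all _ fun x => (L x).le_opNorm_of_le (hC x))

lemma exists_boundedContinuous_lt_integral_apply [NormalSpace X] [BorelSpace X]
    [IsFiniteMeasure m] [m.WeaklyRegular] (hK : Convex ℝ K) (hne : K.Nonempty)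
    (hLm : StronglyMeasurable L) (hL : Integrable L m) {c : ℝ}
    (hc : (c : EReal) < erealIntegral m fun x => supportFunction K (L x)) :
    ∃ w : X →ᵇ E, (∀ x, w x ∈ K) ∧ c < ∫ x, L x (w x) ∂m := by
  obtain ⟨k, hk, hdense⟩ := exists_seq_mem_dense hne
  set hull : ℕ → Set E := fun N => convexHull ℝ (k '' Set.Iic N)
  have hbdd (N : ℕ) : Bornology.IsBounded (hull N) :=
    isBounded_convexHull.2 ((Set.finite_Iic N).image k).isBounded
  have hull_subset (N : ℕ) : hull N ⊆ K :=
    convexHull_min (Set.image_subset_iff.2 fun n _ => hk n) hK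
  choose g hg hgN using fun N => exists_isContinuousLimit_apply_eq_partialSups (m := m)
    (convex_convexHull ℝ (k '' Set.Iic N)) hLm (N := N)
    fun n hn => subset_convexHull ℝ _ (Set.mem_image_of_mem k hn)
  have hint (N : ℕ) : Integrable (fun x => L x (g N x)) m := by
    obtain ⟨C, hC⟩ := (hbdd N).exists_norm_le
    exact integrable_dual_apply hL (hg N).stronglyMeasurable.aestronglyMeasurable
      fun x => hC _ ((hg N).mem x)
  have hlim : Tendsto (fun N => ((∫ x, L x (g N x) ∂m : ℝ) : EReal)) atTop
      (𝓝 (erealIntegral m fun x => supportFunction K (L x))) := by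
    simp only [← erealIntegral_coe (hint _)]
    refine tendsto_erealIntegral_of_monotone (fun N => ?_) (fun x => ?_) (fun x => ?_)
      (hint 0).neg.lintegral_lt_top.ne
    · exact (stronglyMeasurable_dual_apply hLm
        (hg N).stronglyMeasurable).measurable.coe_real_ereal
    · simpa only [hgN] using (partialSups _).monotone
    · simpa only [hgN, supportFunction_eq_iSup_of_dense hk hdense, iSup_partialSups_eq] using
        tendsto_atTop_iSup (partialSups fun n => ((L x (k n) : ℝ) : EReal)).monotone
  obtain ⟨N, hN⟩ := (hlim.eventually (lt_mem_nhds hc)).exists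
  obtain ⟨w, hw, hcw⟩ :=
    (hg N).exists_lt_integral_apply (hbdd N) hL (EReal.coe_lt_coe_iff.1 hN)
  exact ⟨w, fun x => hull_subset N (hw x), hcw⟩

theorem erealIntegral_supportFunction_eq_iSup [NormalSpace X] [BorelSpace X]
    [IsFiniteMeasure m] [m.WeaklyRegular] (hK : Convex ℝ K) (hne : K.Nonempty)
    (hLm : StronglyMeasurable L) (hL : Integrable L m) :
    erealIntegral m (fun x => supportFunction K (L x)) =
      ⨆ w : {w : X →ᵇ E // ∀ x, w x ∈ K}, ((∫ x, L x (w.1 x) ∂m : ℝ) : EReal) := by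
  refine le_antisymm (EReal.ge_of_forall_gt_iff_ge.1 fun c hc => ?_) (iSup_le fun w => ?_)
  · obtain ⟨w, hw, hcw⟩ := exists_boundedContinuous_lt_integral_apply hK hne hLm hL hc
    exact le_iSup_of_le ⟨w, hw⟩ (EReal.coe_le_coe hcw.le)
  · rw [← erealIntegral_coe (integrable_dual_apply hL
      w.1.continuous.aestronglyMeasurable w.1.norm_coe_le_norm)]
    exact erealIntegral_mono fun x => le_supportFunction (w.2 x) (L x)

end ContinuousSelection

section FDivergence

open ContinuousLinearMap (fst snd)
open scoped BoundedContinuousFunction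

variable {X : Type*} [MeasurableSpace X]

section LebesgueDecomposition

variable {E : Type*} [NormedAddCommGroup E] [NormedSpace ℝ E] {μ ν : Measure X} [SigmaFinite μ]

lemma integrable_rnDeriv_smul {v : X → E} (hv : Integrable v μ) :
    Integrable (fun x => (μ.rnDeriv ν x).toReal • v x) ν :=
  (integrable_withDensity_iff_integrable_smul' (Measure.measurable_rnDeriv μ ν)
    (Measure.rnDeriv_lt_top μ ν)).1 (hv.mono_measure (Measure.withDensity_rnDeriv_le μ ν))

lemma integral_eq_integral_rnDeriv_smul_add_integral_singularPart
    [μ.HaveLebesgueDecomposition ν] {v : X → E} (hv : Integrable v μ) :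
    ∫ x, v x ∂μ = ∫ x, (μ.rnDeriv ν x).toReal • v x ∂ν + ∫ x, v x ∂(μ.singularPart ν) := by
  rw [← integral_withDensity_eq_integral_toReal_smul (Measure.measurable_rnDeriv μ ν)
    (Measure.rnDeriv_lt_top μ ν), ← integral_add_measure
      (hv.mono_measure (Measure.withDensity_rnDeriv_le μ ν))
      (hv.mono_measure (Measure.singularPart_le μ ν)), μ.rnDeriv_add_singularPart ν]

end LebesgueDecomposition

/-- The density of the pair `(ν, ξ)` with respect to `ν + ξ.singularPart ν`, as a linear functional
on `ℝ × ℝ`: it is `(1, dξ/dν)` on a set carrying `ν` and `(0, 1)` on the complementary set, which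
carries the singular part of `ξ`. -/
noncomputable def densityFunctional (ν ξ : Measure X) : X → StrongDual ℝ (ℝ × ℝ) :=
  open scoped Classical in
  (Measure.mutuallySingular_singularPart ξ ν).nullSet.piecewise
    (fun x => fst ℝ ℝ ℝ + (ξ.rnDeriv ν x).toReal • snd ℝ ℝ ℝ) fun _ => snd ℝ ℝ ℝ

lemma stronglyMeasurable_densityFunctional (ν ξ : Measure X) :
    StronglyMeasurable (densityFunctional ν ξ) := by
  have hrn : StronglyMeasurable fun x => (ξ.rnDeriv ν x).toReal :=
    (Measure.measurable_rnDeriv ξ ν).ennreal_toReal.stronglyMeasurable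
  exact (stronglyMeasurable_const.add (hrn.smul_const _)).piecewise
    (Measure.MutuallySingular.measurableSet_nullSet _) stronglyMeasurable_const

lemma densityFunctional_ae_eq (ν ξ : Measure X) :
    densityFunctional ν ξ =ᵐ[ν] fun x => fst ℝ ℝ ℝ + (ξ.rnDeriv ν x).toReal • snd ℝ ℝ ℝ := by
  filter_upwards [measure_eq_zero_iff_ae_notMem.1
    (Measure.mutuallySingular_singularPart ξ ν).measure_compl_nullSet] with x hx
  exact if_pos (not_not.1 hx)

lemma densityFunctional_ae_eq_snd (ν ξ : Measure X) :
    densityFunctional ν ξ =ᵐ[ξ.singularPart ν] fun _ => snd ℝ ℝ ℝ := by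
  filter_upwards [measure_eq_zero_iff_ae_notMem.1
    (Measure.mutuallySingular_singularPart ξ ν).measure_nullSet] with x hx
  exact if_neg hx

lemma integrable_densityFunctional (ν ξ : Measure X) [IsFiniteMeasure ν] [IsFiniteMeasure ξ] :
    Integrable (densityFunctional ν ξ) (ν + ξ.singularPart ν) := by
  refine Integrable.add_measure ?_ ?_
  · rw [integrable_congr (densityFunctional_ae_eq ν ξ)]
    exact (integrable_const (fst ℝ ℝ ℝ)).add
      (Measure.integrable_toReal_rnDeriv.smul_const (snd ℝ ℝ ℝ))
  · rw [integrable_congr (densityFunctional_ae_eq_snd ν ξ)]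
    exact integrable_const _

lemma integral_densityFunctional_apply {ν ξ : Measure X} [SigmaFinite ξ]
    [ξ.HaveLebesgueDecomposition ν] {w : X → ℝ × ℝ} (hν : Integrable (fun x => (w x).1) ν)
    (hξ : Integrable (fun x => (w x).2) ξ) :
    ∫ x, densityFunctional ν ξ x (w x) ∂(ν + ξ.singularPart ν) =
      ∫ x, (w x).1 ∂ν + ∫ x, (w x).2 ∂ξ := by
  have hae : (fun x => densityFunctional ν ξ x (w x)) =ᵐ[ν]
      fun x => (w x).1 + (ξ.rnDeriv ν x).toReal • (w x).2 := by
    filter_upwards [densityFunctional_ae_eq ν ξ] with x hx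
    simp [hx]
  have hae_snd : (fun x => densityFunctional ν ξ x (w x)) =ᵐ[ξ.singularPart ν]
      fun x => (w x).2 := by
    filter_upwards [densityFunctional_ae_eq_snd ν ξ] with x hx
    simp [hx]
  have hac := hν.add (integrable_rnDeriv_smul (ν := ν) hξ)
  rw [integral_add_measure (hac.congr hae.symm)
      ((hξ.mono_measure (Measure.singularPart_le ξ ν)).congr hae_snd.symm),
    integral_congr_ae hae, integral_congr_ae hae_snd,
    integral_add hν (integrable_rnDeriv_smul hξ), add_assoc,
    ← integral_eq_integral_rnDeriv_smul_add_integral_singularPart hξ]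

lemma fDivergence_self (φ : ℝ → EReal) (ν : ProbabilityMeasure X) : fDivergence φ ν ν = φ 1 := by
  have hrn : (fun x => φ ((ν : Measure X).rnDeriv ν x).toReal) =ᵐ[(ν : Measure X)]
      fun _ => φ 1 := by
    filter_upwards [Measure.rnDeriv_self (ν : Measure X)] with x hx
    simp [hx]
  simp [fDivergence, erealIntegral_congr_ae hrn, erealIntegral_const, Measure.singularPart_self]

variable {φ : ℝ → EReal}

lemma fDivergence_eq_erealIntegral_supportFunction (hφ_proper : IsProperFn φ)
    (hφ_convex : IsConvexFn φ) (hφ_lsc : LowerSemicontinuous φ) (ξ ν : ProbabilityMeasure X) :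
    fDivergence φ ξ ν = erealIntegral ((ν : Measure X) + (ξ : Measure X).singularPart ν)
      fun x => supportFunction (affineMinorants φ) (densityFunctional (ν : Measure X) ξ x) := by
  have hν := (densityFunctional_ae_eq (ν : Measure X) ξ).fun_comp
    (supportFunction (affineMinorants φ))
  have hξ := (densityFunctional_ae_eq_snd (ν : Measure X) ξ).fun_comp
    (supportFunction (affineMinorants φ))
  simp only [Function.comp_def,
    supportFunction_affineMinorants_fst_add_smul_snd hφ_proper hφ_convex hφ_lsc] at hν
  simp only [Function.comp_def, supportFunction_affineMinorants_snd
    (affineMinorants_nonempty hφ_proper hφ_convex hφ_lsc)] at hξ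
  rw [erealIntegral_add_measure, erealIntegral_congr_ae hν, erealIntegral_congr_ae hξ,
    erealIntegral_const, fDivergence]

variable [TopologicalSpace X] [BorelSpace X]

lemma fDivergence_eq_iSup [NormalSpace X] (hφ_proper : IsProperFn φ) (hφ_convex : IsConvexFn φ)
    (hφ_lsc : LowerSemicontinuous φ) (ξ ν : ProbabilityMeasure X)
    [((ν : Measure X) + (ξ : Measure X).singularPart ν).WeaklyRegular] :
    fDivergence φ ξ ν = ⨆ w : {w : X →ᵇ ℝ × ℝ // ∀ x, w x ∈ affineMinorants φ},
      ((∫ x, (w.1 x).1 ∂(ν : Measure X) + ∫ x, (w.1 x).2 ∂(ξ : Measure X) : ℝ) : EReal) := by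
  rw [fDivergence_eq_erealIntegral_supportFunction hφ_proper hφ_convex hφ_lsc,
    erealIntegral_supportFunction_eq_iSup (convex_affineMinorants φ)
      (affineMinorants_nonempty hφ_proper hφ_convex hφ_lsc)
      (stronglyMeasurable_densityFunctional _ _) (integrable_densityFunctional _ _)]
  simp only [integral_densityFunctional_apply (BoundedContinuousFunction.integrable _ _).fst
    (BoundedContinuousFunction.integrable _ _).snd]

lemma lowerSemicontinuous_fDivergence [TopologicalSpace.PseudoMetrizableSpace X]
    (hφ_proper : IsProperFn φ) (hφ_convex : IsConvexFn φ) (hφ_lsc : LowerSemicontinuous φ)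
    (ν : ProbabilityMeasure X) : LowerSemicontinuous fun ξ => fDivergence φ ξ ν := by
  simp only [fDivergence_eq_iSup hφ_proper hφ_convex hφ_lsc]
  refine lowerSemicontinuous_iSup fun w => Continuous.lowerSemicontinuous ?_
  have hsnd : Continuous fun ξ : ProbabilityMeasure X => ∫ x, (w.1 x).2 ∂(ξ : Measure X) :=
    ProbabilityMeasure.continuous_integral_boundedContinuousFunction
      ((snd ℝ ℝ ℝ).compLeftContinuousBounded X w.1)
  exact continuous_coe_real_ereal.comp (continuous_const.add hsnd)

lemma exists_real_le_fDivergence [TopologicalSpace.PseudoMetrizableSpace X]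
    (hφ_proper : IsProperFn φ) (hφ_convex : IsConvexFn φ) (hφ_lsc : LowerSemicontinuous φ)
    (ν : ProbabilityMeasure X) : ∃ m : ℝ, ∀ ξ, (m : EReal) ≤ fDivergence φ ξ ν := by
  obtain ⟨p, hp⟩ := affineMinorants_nonempty hφ_proper hφ_convex hφ_lsc
  refine ⟨p.1 + p.2, fun ξ => ?_⟩
  rw [fDivergence_eq_iSup hφ_proper hφ_convex hφ_lsc]
  exact le_iSup_of_le ⟨.const X p, fun _ => hp⟩ (by simp)

end FDivergence

section Couplings

lemma exists_measure_fst_eq_map_snd_eq {Y Z T : Type*} [MeasurableSpace Y] [MeasurableSpace Z]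
    [MeasurableSpace T] [StandardBorelSpace T] [Nonempty T] {π : Measure (Y × Z)} [SFinite π]
    {π' : Measure (Z × T)} [IsFiniteMeasure π'] (h : π.snd = π'.fst) :
    ∃ ρ : Measure ((Y × Z) × T), ρ.fst = π ∧ ρ.map (fun z => (z.1.2, z.2)) = π' := by
  set κ : ProbabilityTheory.Kernel (Y × Z) T := π'.condKernel.comap Prod.snd measurable_snd
  have hm : Measurable fun z : (Y × Z) × T => (z.1.2, z.2) := by fun_prop
  refine ⟨π.compProd κ, Measure.fst_compProd π κ, ?_⟩
  calc (π.compProd κ).map (fun z => (z.1.2, z.2)) = π.snd.compProd π'.condKernel := by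
        ext s hs
        rw [Measure.map_apply hm hs, Measure.compProd_apply (hm hs), Measure.snd,
          Measure.compProd_apply hs,
          lintegral_map (ProbabilityTheory.Kernel.measurable_kernel_prodMk_left hs) measurable_snd]
        rfl
    _ = π' := by rw [h, π'.disintegrate π'.condKernel]

variable {X : Type*} [MeasurableSpace X] {μ ν : ProbabilityMeasure X}

lemma prod_mem_couplings (μ ν : ProbabilityMeasure X) : μ.prod ν ∈ couplings μ ν := by
  constructor <;> simp

instance nonempty_couplings (μ ν : ProbabilityMeasure X) : Nonempty (couplings μ ν) :=
  ⟨⟨_, prod_mem_couplings μ ν⟩⟩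

lemma map_diag_mem_couplings (μ : ProbabilityMeasure X) :
    μ.map (measurable_id.prodMk measurable_id).aemeasurable ∈ couplings μ μ := by
  have hdiag : Measurable fun x : X => (x, x) := measurable_id.prodMk measurable_id
  exact ⟨(Measure.map_map measurable_fst hdiag).trans Measure.map_id,
    (Measure.map_map measurable_snd hdiag).trans Measure.map_id⟩

lemma map_swap_mem_couplings {π : ProbabilityMeasure (X × X)} (hπ : π ∈ couplings μ ν) :
    π.map measurable_swap.aemeasurable ∈ couplings ν μ :=
  ⟨(Measure.map_map measurable_fst measurable_swap).trans hπ.2,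
    (Measure.map_map measurable_snd measurable_swap).trans hπ.1⟩

lemma mem_couplings_iff {π : ProbabilityMeasure (X × X)} :
    π ∈ couplings μ ν ↔ π.map (f := Prod.fst) measurable_fst.aemeasurable = μ ∧
      π.map (f := Prod.snd) measurable_snd.aemeasurable = ν :=
  ⟨fun h => ⟨Subtype.ext h.1, Subtype.ext h.2⟩,
    fun h => ⟨congrArg Subtype.val h.1, congrArg Subtype.val h.2⟩⟩

lemma isClosed_couplings [TopologicalSpace X] [SecondCountableTopology X] [HasOuterApproxClosed X]
    [BorelSpace X] (μ ν : ProbabilityMeasure X) : IsClosed (couplings μ ν) := by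
  have hinter : couplings μ ν = {π | π.map (f := Prod.fst) measurable_fst.aemeasurable = μ} ∩
      {π | π.map (f := Prod.snd) measurable_snd.aemeasurable = ν} :=
    Set.ext fun π => mem_couplings_iff
  rw [hinter]
  exact (isClosed_eq (ProbabilityMeasure.continuous_map continuous_fst) continuous_const).inter
    (isClosed_eq (ProbabilityMeasure.continuous_map continuous_snd) continuous_const)

lemma integral_sub_eq_integral_coupling {π : ProbabilityMeasure (X × X)} (hπ : π ∈ couplings μ ν)
    {v : X → ℝ} (hμ : Integrable v (μ : Measure X)) (hν : Integrable v (ν : Measure X)) :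
    ∫ x, v x ∂(μ : Measure X) - ∫ x, v x ∂(ν : Measure X) =
      ∫ z, (v z.1 - v z.2) ∂(π : Measure (X × X)) := by
  rw [← hπ.1] at hμ
  rw [← hπ.2] at hν
  have hsub := integral_sub (hμ.comp_measurable measurable_fst) (hν.comp_measurable measurable_snd)
  simp only [Function.comp_def] at hsub
  rw [hsub, ← integral_map measurable_fst.aemeasurable hμ.aestronglyMeasurable,
    ← integral_map measurable_snd.aemeasurable hν.aestronglyMeasurable, hπ.1, hπ.2]

lemma exists_gluing [StandardBorelSpace X] {μ₁ μ₂ μ₃ : ProbabilityMeasure X}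
    {π π' : ProbabilityMeasure (X × X)} (hπ : π ∈ couplings μ₁ μ₂) (hπ' : π' ∈ couplings μ₂ μ₃) :
    ∃ ρ : ProbabilityMeasure ((X × X) × X), (ρ : Measure ((X × X) × X)).map Prod.fst = π ∧
      (ρ : Measure ((X × X) × X)).map (fun z => (z.1.2, z.2)) = π' ∧
      ρ.map (f := fun z => (z.1.1, z.2)) (by fun_prop) ∈ couplings μ₁ μ₃ := by
  have : Nonempty X := nonempty_of_isProbabilityMeasure (μ₁ : Measure X)
  obtain ⟨ρ, hρπ, hρπ'⟩ := exists_measure_fst_eq_map_snd_eq (hπ.2.trans hπ'.1.symm)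
  have : IsProbabilityMeasure (ρ.map Prod.fst) := by
    rw [← Measure.fst, hρπ]
    infer_instance
  have : IsProbabilityMeasure ρ := Measure.isProbabilityMeasure_of_map Prod.fst
  have hm : Measurable fun z : (X × X) × X => (z.1.2, z.2) := by fun_prop
  have hm₁₃ : Measurable fun z : (X × X) × X => (z.1.1, z.2) := by fun_prop
  refine ⟨⟨ρ, this⟩, hρπ, hρπ', ?_, ?_⟩
  · rw [← hπ.1, ← hρπ]
    exact (Measure.map_map measurable_fst hm₁₃).trans
      (Measure.map_map measurable_fst measurable_fst).symm
  · rw [← hπ'.2, ← hρπ']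
    exact (Measure.map_map measurable_snd hm₁₃).trans (Measure.map_map measurable_snd hm).symm

end Couplings

section CompactSpace

variable {Y E : Type*} [NormedAddCommGroup E]

lemma exists_dist_le_add_mul_dist [PseudoMetricSpace Y] [CompactSpace Y] (v : C(Y, E)) {ε : ℝ}
    (hε : 0 < ε) : ∃ L : ℝ, ∀ x y, dist (v x) (v y) ≤ ε + L * dist x y := by
  obtain ⟨δ, hδ, hvδ⟩ := Metric.uniformContinuous_iff.1
    (CompactSpace.uniformContinuous_of_continuous v.continuous) ε hε
  refine ⟨2 * ‖v‖ / δ, fun x y => ?_⟩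
  rcases lt_or_ge (dist x y) δ with hxy | hxy
  · exact (hvδ hxy).le.trans (le_add_of_nonneg_right (by positivity))
  · calc dist (v x) (v y) ≤ 2 * ‖v‖ / δ * δ := by
          rw [div_mul_cancel₀ _ hδ.ne']
          exact v.dist_le_two_norm x y
      _ ≤ 2 * ‖v‖ / δ * dist x y := by gcongr
      _ ≤ ε + 2 * ‖v‖ / δ * dist x y := le_add_of_nonneg_left hε.le

lemma integrable_of_continuous [TopologicalSpace Y] [CompactSpace Y] [MeasurableSpace Y]
    [OpensMeasurableSpace Y] [SecondCountableTopologyEither Y E] {f : Y → E}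
    (hf : Continuous f) (m : Measure Y) [IsFiniteMeasure m] : Integrable f m :=
  hf.integrable_of_hasCompactSupport (HasCompactSupport.of_compactSpace f)

end CompactSpace

section Wasserstein

variable {X : Type*} [MetricSpace X] [MeasurableSpace X]

lemma integral_dist_nonneg (π : Measure (X × X)) : 0 ≤ ∫ z, dist z.1 z.2 ∂π :=
  integral_nonneg fun _ => dist_nonneg

lemma wasserstein1_le_integral {μ ν : ProbabilityMeasure X} {π : ProbabilityMeasure (X × X)}
    (hπ : π ∈ couplings μ ν) : wasserstein1 μ ν ≤ ∫ z, dist z.1 z.2 ∂(π : Measure (X × X)) :=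
  ciInf_le (f := fun π : couplings μ ν => ∫ z, dist z.1 z.2 ∂(π.1 : Measure (X × X)))
    ⟨0, Set.forall_mem_range.2 fun _ => integral_dist_nonneg _⟩ ⟨π, hπ⟩

lemma wasserstein1_nonneg (μ ν : ProbabilityMeasure X) : 0 ≤ wasserstein1 μ ν :=
  Real.iInf_nonneg fun _ => integral_dist_nonneg _

lemma wasserstein1_comm (μ ν : ProbabilityMeasure X) : wasserstein1 μ ν = wasserstein1 ν μ := by
  have hle (μ ν : ProbabilityMeasure X) : wasserstein1 μ ν ≤ wasserstein1 ν μ := by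
    refine le_ciInf fun π => (wasserstein1_le_integral (map_swap_mem_couplings π.2)).trans_eq ?_
    refine (integral_map_equiv MeasurableEquiv.prodComm _).trans ?_
    exact integral_congr_ae (.of_forall fun z => dist_comm z.2 z.1)
  exact le_antisymm (hle μ ν) (hle ν μ)

lemma wasserstein1_self [OpensMeasurableSpace X] [SecondCountableTopology X]
    (μ : ProbabilityMeasure X) : wasserstein1 μ μ = 0 := by
  refine le_antisymm ((wasserstein1_le_integral (map_diag_mem_couplings μ)).trans_eq ?_)
    (wasserstein1_nonneg μ μ)
  rw [ProbabilityMeasure.toMeasure_map, integral_map (by fun_prop)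
    measurable_dist.aestronglyMeasurable]
  simp

variable [CompactSpace X] [BorelSpace X]

lemma continuous_integral_dist :
    Continuous fun π : ProbabilityMeasure (X × X) => ∫ z, dist z.1 z.2 ∂(π : Measure (X × X)) :=
  ProbabilityMeasure.continuous_integral_continuousMap
    (⟨fun z => dist z.1 z.2, continuous_dist⟩ : C(X × X, ℝ))

lemma exists_optimal_coupling (μ ν : ProbabilityMeasure X) :
    ∃ π ∈ couplings μ ν, ∫ z, dist z.1 z.2 ∂(π : Measure (X × X)) = wasserstein1 μ ν := by
  obtain ⟨π, hπ, hmin⟩ := (isClosed_couplings μ ν).isCompact.exists_isMinOn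
    ⟨_, prod_mem_couplings μ ν⟩ continuous_integral_dist.continuousOn
  exact ⟨π, hπ, le_antisymm (le_ciInf fun π' => hmin π'.2) (wasserstein1_le_integral hπ)⟩

lemma wasserstein1_le_diam (μ ν : ProbabilityMeasure X) :
    wasserstein1 μ ν ≤ Metric.diam (Set.univ : Set X) := by
  calc wasserstein1 μ ν ≤ ∫ z, dist z.1 z.2 ∂(μ.prod ν : Measure (X × X)) :=
        wasserstein1_le_integral (prod_mem_couplings μ ν)
    _ ≤ ∫ _, Metric.diam (Set.univ : Set X) ∂(μ.prod ν : Measure (X × X)) :=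
        integral_mono (integrable_of_continuous continuous_dist _) (integrable_const _) fun z =>
          Metric.dist_le_diam_of_mem isCompact_univ.isBounded (Set.mem_univ _) (Set.mem_univ _)
    _ = Metric.diam (Set.univ : Set X) := by simp

lemma wasserstein1_triangle (μ₁ μ₂ μ₃ : ProbabilityMeasure X) :
    wasserstein1 μ₁ μ₃ ≤ wasserstein1 μ₁ μ₂ + wasserstein1 μ₂ μ₃ := by
  obtain ⟨π, hπ, hW⟩ := exists_optimal_coupling μ₁ μ₂
  obtain ⟨π', hπ', hW'⟩ := exists_optimal_coupling μ₂ μ₃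
  obtain ⟨ρ, hρπ, hρπ', hρ⟩ := exists_gluing hπ hπ'
  calc wasserstein1 μ₁ μ₃ ≤ ∫ z, dist z.1 z.2 ∂(ρ.toMeasure.map fun z => (z.1.1, z.2)) :=
        wasserstein1_le_integral hρ
    _ = ∫ z, dist z.1.1 z.2 ∂ρ.toMeasure :=
        integral_map (by fun_prop) measurable_dist.aestronglyMeasurable
    _ ≤ ∫ z, (dist z.1.1 z.1.2 + dist z.1.2 z.2) ∂ρ.toMeasure :=
        integral_mono (integrable_of_continuous (by fun_prop) _)
          (integrable_of_continuous (by fun_prop) _) fun z => dist_triangle _ _ _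
    _ = ∫ z, dist z.1.1 z.1.2 ∂ρ.toMeasure + ∫ z, dist z.1.2 z.2 ∂ρ.toMeasure :=
        integral_add (integrable_of_continuous (by fun_prop) _)
          (integrable_of_continuous (by fun_prop) _)
    _ = wasserstein1 μ₁ μ₂ + wasserstein1 μ₂ μ₃ := by
        rw [← hW, ← hW', ← hρπ, ← hρπ',
          integral_map measurable_fst.aemeasurable measurable_dist.aestronglyMeasurable,
          integral_map (by fun_prop) measurable_dist.aestronglyMeasurable]

lemma exists_abs_integral_sub_le_add_mul_wasserstein1 (v : C(X, ℝ)) {ε : ℝ} (hε : 0 < ε) :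
    ∃ L : ℝ, ∀ μ ξ : ProbabilityMeasure X,
      |∫ x, v x ∂(μ : Measure X) - ∫ x, v x ∂(ξ : Measure X)| ≤ ε + L * wasserstein1 μ ξ := by
  obtain ⟨L, hL⟩ := exists_dist_le_add_mul_dist v hε
  refine ⟨L, fun μ ξ => ?_⟩
  obtain ⟨π, hπ, hW⟩ := exists_optimal_coupling μ ξ
  have hdist : Integrable (fun z : X × X => L * dist z.1 z.2) (π : Measure (X × X)) :=
    integrable_of_continuous (by fun_prop) _
  rw [integral_sub_eq_integral_coupling hπ (integrable_of_continuous v.continuous _)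
    (integrable_of_continuous v.continuous _)]
  calc |∫ z, (v z.1 - v z.2) ∂(π : Measure (X × X))|
      ≤ ∫ z, |v z.1 - v z.2| ∂(π : Measure (X × X)) := abs_integral_le_integral_abs
    _ ≤ ∫ z, (ε + L * dist z.1 z.2) ∂(π : Measure (X × X)) :=
        integral_mono (integrable_of_continuous (by fun_prop) _)
          ((integrable_const ε).add hdist) fun z => hL z.1 z.2
    _ = ε + L * wasserstein1 μ ξ := by
        rw [integral_add (integrable_const ε) hdist, integral_const_mul, hW]
        simp

lemma tendsto_of_tendsto_wasserstein1 {ι : Type*} {l : Filter ι} {μ : ProbabilityMeasure X}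
    {ξ : ι → ProbabilityMeasure X} (h : Tendsto (fun i => wasserstein1 μ (ξ i)) l (𝓝 0)) :
    Tendsto ξ l (𝓝 μ) := by
  refine ProbabilityMeasure.tendsto_iff_forall_integral_tendsto.2 fun f =>
    Metric.tendsto_nhds.2 fun ε hε => ?_
  obtain ⟨L, hL⟩ := exists_abs_integral_sub_le_add_mul_wasserstein1 f.toContinuousMap (half_pos hε)
  have hlim : Tendsto (fun i => ε / 2 + L * wasserstein1 μ (ξ i)) l (𝓝 (ε / 2)) := by
    simpa using (h.const_mul L).const_add (ε / 2)
  filter_upwards [hlim.eventually_lt_const (half_lt_self hε)] with i hi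
  rw [dist_comm]
  exact (hL μ (ξ i)).trans_lt hi

lemma lowerSemicontinuous_wasserstein1 (μ : ProbabilityMeasure X) :
    LowerSemicontinuous (wasserstein1 μ) := by
  refine lowerSemicontinuous_iff_isClosed_preimage.2 fun c => ?_
  have hS : IsClosed {π : ProbabilityMeasure (X × X) |
      π.map (f := Prod.fst) measurable_fst.aemeasurable = μ ∧
        ∫ z, dist z.1 z.2 ∂(π : Measure (X × X)) ≤ c} :=
    (isClosed_eq (ProbabilityMeasure.continuous_map continuous_fst) continuous_const).inter
      (isClosed_le continuous_integral_dist continuous_const)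
  convert (hS.isCompact.image (ProbabilityMeasure.continuous_map continuous_snd)).isClosed using 1
  ext ξ
  constructor
  · intro hξ
    obtain ⟨π, hπ, hW⟩ := exists_optimal_coupling μ ξ
    obtain ⟨hfst, hsnd⟩ := mem_couplings_iff.1 hπ
    exact ⟨π, ⟨hfst, hW.trans_le hξ⟩, hsnd⟩
  · rintro ⟨π, ⟨hfst, hc⟩, hsnd⟩
    exact (wasserstein1_le_integral (mem_couplings_iff.2 ⟨hfst, hsnd⟩)).trans hc

end Wasserstein

section RpowModulus

variable {α a b w : ℝ}

lemma rpow_le_rpow_add_rpow_of_le_one (hα₀ : 0 ≤ α) (hα : α ≤ 1) (ha : 0 ≤ a) (hb : 0 ≤ b)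
    (hw : 0 ≤ w) (hab : a ≤ w + b) : a ^ α ≤ b ^ α + w ^ α := by
  rw [add_comm]
  exact (Real.rpow_le_rpow ha hab hα₀).trans (Real.rpow_add_le_add_rpow hw hb hα₀ hα)

lemma rpow_le_rpow_add_mul_of_one_le {D : ℝ} (hα : 1 ≤ α) (ha : 0 ≤ a) (hb : 0 ≤ b) (hw : 0 ≤ w)
    (haD : a ≤ D) (hab : a ≤ w + b) : a ^ α ≤ b ^ α + α * D ^ (α - 1) * w := by
  have hD : 0 ≤ D := ha.trans haD
  rcases ha.eq_or_lt with rfl | ha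
  · rw [Real.zero_rpow (by linarith)]
    positivity
  · have hbernoulli : a ^ α + α * (a ^ (α - 1) * (b - a)) ≤ b ^ α := by
      have h := one_add_mul_self_le_rpow_one_add (s := b / a - 1)
        (by linarith [div_nonneg hb ha.le]) hα
      rw [add_sub_cancel, Real.div_rpow hb ha.le, le_div_iff₀ (Real.rpow_pos_of_pos ha α)] at h
      refine le_of_eq_of_le ?_ h
      rw [Real.rpow_sub_one ha.ne']
      field_simp
    have hslope : α * (a ^ (α - 1) * (a - b)) ≤ α * (D ^ (α - 1) * w) :=
      calc α * (a ^ (α - 1) * (a - b)) ≤ α * (a ^ (α - 1) * w) := by gcongr; linarith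
        _ ≤ α * (D ^ (α - 1) * w) := by gcongr
    linarith

end RpowModulus

section MoreauEnvelope

variable {X : Type*} [MetricSpace X] [MeasurableSpace X]

/-- The Moreau–Yosida regularization of a functional `F` on the probability measures, with penalty
`l * W₁ ^ α`. The divergence `moreauYosidaDivergence φ l α · ν` is the case
`F = fDivergence φ · ν`. -/
noncomputable def moreauEnvelope (F : ProbabilityMeasure X → EReal) (l α : ℝ)
    (μ : ProbabilityMeasure X) : EReal :=
  ⨅ ξ : ProbabilityMeasure X, F ξ + ((l * wasserstein1 μ ξ ^ α : ℝ) : EReal)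

variable {F : ProbabilityMeasure X → EReal} {l α m : ℝ}

lemma moreauEnvelope_le (F : ProbabilityMeasure X → EReal) (l α : ℝ) (μ ξ : ProbabilityMeasure X) :
    moreauEnvelope F l α μ ≤ F ξ + ((l * wasserstein1 μ ξ ^ α : ℝ) : EReal) :=
  iInf_le _ ξ

lemma le_add_mul_wasserstein1_rpow (hl : 0 ≤ l) (μ ξ : ProbabilityMeasure X) :
    F ξ ≤ F ξ + ((l * wasserstein1 μ ξ ^ α : ℝ) : EReal) :=
  le_add_of_nonneg_right <| EReal.coe_nonneg.2 <|
    mul_nonneg hl (Real.rpow_nonneg (wasserstein1_nonneg μ ξ) α)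

lemma coe_le_moreauEnvelope (hl : 0 ≤ l) (hm : ∀ ξ, (m : EReal) ≤ F ξ)
    (μ : ProbabilityMeasure X) : (m : EReal) ≤ moreauEnvelope F l α μ :=
  le_iInf fun ξ => (hm ξ).trans (le_add_mul_wasserstein1_rpow hl μ ξ)

lemma moreauEnvelope_ne_top_ne_bot (hl : 0 ≤ l) (hm : ∀ ξ, (m : EReal) ≤ F ξ)
    (hF : ∃ ξ, F ξ ≠ ⊤) (μ : ProbabilityMeasure X) :
    moreauEnvelope F l α μ ≠ ⊤ ∧ moreauEnvelope F l α μ ≠ ⊥ := by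
  obtain ⟨ξ, hξ⟩ := hF
  exact ⟨((moreauEnvelope_le F l α μ ξ).trans_lt (EReal.add_lt_top hξ (EReal.coe_ne_top _))).ne,
    ((EReal.bot_lt_coe m).trans_le (coe_le_moreauEnvelope hl hm μ)).ne'⟩

lemma moreauEnvelope_le_self [OpensMeasurableSpace X] [SecondCountableTopology X] (hα : α ≠ 0)
    (μ : ProbabilityMeasure X) : moreauEnvelope F l α μ ≤ F μ := by
  simpa [wasserstein1_self, Real.zero_rpow hα] using moreauEnvelope_le F l α μ μ

lemma isHolderW1_of_le_add {G : ProbabilityMeasure X → EReal} {C r : ℝ}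
    (hfin : ∀ μ, G μ ≠ ⊤ ∧ G μ ≠ ⊥)
    (hG : ∀ μ₁ μ₂, G μ₁ ≤ G μ₂ + ((C * wasserstein1 μ₁ μ₂ ^ r : ℝ) : EReal)) :
    IsHolderW1 C r G := by
  have hreal (μ₁ μ₂) : (G μ₁).toReal - (G μ₂).toReal ≤ C * wasserstein1 μ₁ μ₂ ^ r := by
    rw [sub_le_iff_le_add', ← EReal.coe_le_coe_iff, EReal.coe_add,
      EReal.coe_toReal (hfin μ₁).1 (hfin μ₁).2, EReal.coe_toReal (hfin μ₂).1 (hfin μ₂).2]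
    exact hG μ₁ μ₂
  exact ⟨hfin, fun μ₁ μ₂ => abs_sub_le_iff.2
    ⟨hreal μ₁ μ₂, wasserstein1_comm μ₂ μ₁ ▸ hreal μ₂ μ₁⟩⟩

variable [CompactSpace X] [BorelSpace X]

lemma lowerSemicontinuous_mul_wasserstein1_rpow (hl : 0 ≤ l) (hα : 0 ≤ α)
    (μ : ProbabilityMeasure X) :
    LowerSemicontinuous fun ξ => ((l * wasserstein1 μ ξ ^ α : ℝ) : EReal) := by
  have hcont : Continuous fun t : ℝ => ((l * max t 0 ^ α : ℝ) : EReal) :=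
    continuous_coe_real_ereal.comp <| continuous_const.mul <|
      (continuous_id.max continuous_const).rpow_const fun _ => .inr hα
  have hmono : Monotone fun t : ℝ => ((l * max t 0 ^ α : ℝ) : EReal) := fun s t hst =>
    EReal.coe_le_coe_iff.2 (by gcongr)
  simpa [Function.comp_def, wasserstein1_nonneg] using
    hcont.comp_lowerSemicontinuous (lowerSemicontinuous_wasserstein1 μ) hmono

lemma exists_add_mul_wasserstein1_rpow_eq_moreauEnvelope (hF : LowerSemicontinuous F) (hl : 0 ≤ l)
    (hα : 0 ≤ α) (μ : ProbabilityMeasure X) :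
    ∃ ξ, F ξ + ((l * wasserstein1 μ ξ ^ α : ℝ) : EReal) = moreauEnvelope F l α μ := by
  have hlsc : LowerSemicontinuous fun ξ => F ξ + ((l * wasserstein1 μ ξ ^ α : ℝ) : EReal) :=
    hF.add' (lowerSemicontinuous_mul_wasserstein1_rpow hl hα μ) fun ξ =>
      EReal.continuousAt_add (.inr (EReal.coe_ne_bot _)) (.inr (EReal.coe_ne_top _))
  obtain ⟨ξ, -, hmin⟩ := (hlsc.lowerSemicontinuousOn Set.univ).exists_isMinOn
    ⟨μ, Set.mem_univ μ⟩ isCompact_univ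
  exact ⟨ξ, le_antisymm (le_iInf fun ξ' => hmin (Set.mem_univ ξ')) (moreauEnvelope_le F l α μ ξ)⟩

lemma eventually_le_moreauEnvelope (hF : LowerSemicontinuous F) (hm : ∀ ξ, (m : EReal) ≤ F ξ)
    (hα : 0 ≤ α) {μ : ProbabilityMeasure X} {c : ℝ} (hc : (c : EReal) < F μ) :
    ∀ᶠ l in atTop, (c : EReal) ≤ moreauEnvelope F l α μ := by
  obtain ⟨δ, hδ, hnear⟩ : ∃ δ > 0, ∀ ξ, wasserstein1 μ ξ < δ → (c : EReal) < F ξ := by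
    have hev : ∀ᶠ ξ in comap (wasserstein1 μ) (𝓝 0), (c : EReal) < F ξ :=
      tendsto_of_tendsto_wasserstein1 tendsto_comap (hF μ c hc)
    obtain ⟨δ, hδ, hball⟩ := (Metric.nhds_basis_ball.comap _).eventually_iff.1 hev
    refine ⟨δ, hδ, fun ξ hξ => hball ?_⟩
    simpa [abs_of_nonneg (wasserstein1_nonneg μ ξ)] using hξ
  have hδα : 0 < δ ^ α := Real.rpow_pos_of_pos hδ α
  filter_upwards [eventually_ge_atTop 0, eventually_ge_atTop ((c - m) / δ ^ α)] with l hl₀ hl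
  refine le_iInf fun ξ => ?_
  rcases lt_or_ge (wasserstein1 μ ξ) δ with hξ | hξ
  · exact (hnear ξ hξ).le.trans (le_add_mul_wasserstein1_rpow hl₀ μ ξ)
  · have hfar : c ≤ m + l * wasserstein1 μ ξ ^ α := by
      have hpow : l * δ ^ α ≤ l * wasserstein1 μ ξ ^ α := by gcongr
      linarith [(div_le_iff₀ hδα).1 hl]
    calc (c : EReal) ≤ m + ((l * wasserstein1 μ ξ ^ α : ℝ) : EReal) := by exact_mod_cast hfar
      _ ≤ F ξ + ((l * wasserstein1 μ ξ ^ α : ℝ) : EReal) := by gcongr; exact hm ξ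

lemma tendsto_moreauEnvelope (hF : LowerSemicontinuous F) (hm : ∀ ξ, (m : EReal) ≤ F ξ)
    (hα : 0 < α) (μ : ProbabilityMeasure X) :
    Tendsto (fun l => moreauEnvelope F l α μ) atTop (𝓝 (F μ)) := by
  refine tendsto_order.2 ⟨fun c hc => ?_, fun c hc => .of_forall fun l =>
    (moreauEnvelope_le_self hα.ne' μ).trans_lt hc⟩
  obtain ⟨c', hcc', hc'⟩ := EReal.lt_iff_exists_real_btwn.1 hc
  exact (eventually_le_moreauEnvelope hF hm hα.le hc').mono fun l hl => hcc'.trans_le hl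

lemma eq_iSup_moreauEnvelope (hF : LowerSemicontinuous F) (hm : ∀ ξ, (m : EReal) ≤ F ξ)
    (hα : 0 < α) (μ : ProbabilityMeasure X) :
    F μ = ⨆ (l : ℝ) (_ : 0 < l), moreauEnvelope F l α μ := by
  refine le_antisymm ?_ (iSup₂_le fun l _ => moreauEnvelope_le_self hα.ne' μ)
  refine le_of_tendsto (tendsto_moreauEnvelope hF hm hα μ) ?_
  filter_upwards [eventually_gt_atTop 0] with l hl
  exact le_iSup₂_of_le l hl le_rfl

lemma isHolderW1_moreauEnvelope (hl : 0 ≤ l) (hm : ∀ ξ, (m : EReal) ≤ F ξ) (hF : ∃ ξ, F ξ ≠ ⊤)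
    {C r : ℝ} (hC : ∀ a b w : ℝ, 0 ≤ a → 0 ≤ b → 0 ≤ w → a ≤ Metric.diam (Set.univ : Set X) →
      a ≤ w + b → l * a ^ α ≤ l * b ^ α + C * w ^ r) :
    IsHolderW1 C r (moreauEnvelope F l α) := by
  refine isHolderW1_of_le_add (moreauEnvelope_ne_top_ne_bot hl hm hF) fun μ₁ μ₂ => ?_
  rw [← EReal.sub_le_iff_le_add (.inl (EReal.coe_ne_bot _)) (.inl (EReal.coe_ne_top _))]
  refine le_iInf fun ξ => ?_
  rw [EReal.sub_le_iff_le_add (.inl (EReal.coe_ne_bot _)) (.inl (EReal.coe_ne_top _)), add_assoc,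
    ← EReal.coe_add]
  refine (moreauEnvelope_le F l α μ₁ ξ).trans (add_le_add_right (EReal.coe_le_coe_iff.2 ?_) _)
  exact hC _ _ _ (wasserstein1_nonneg _ _) (wasserstein1_nonneg _ _) (wasserstein1_nonneg _ _)
    (wasserstein1_le_diam _ _) (wasserstein1_triangle _ _ _)

lemma isHolderW1_moreauEnvelope_of_le_one (hl : 0 ≤ l) (hα₀ : 0 ≤ α) (hα : α ≤ 1)
    (hm : ∀ ξ, (m : EReal) ≤ F ξ) (hF : ∃ ξ, F ξ ≠ ⊤) : IsHolderW1 l α (moreauEnvelope F l α) := by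
  refine isHolderW1_moreauEnvelope hl hm hF fun a b w ha hb hw _ hab => ?_
  rw [← mul_add]
  exact mul_le_mul_of_nonneg_left (rpow_le_rpow_add_rpow_of_le_one hα₀ hα ha hb hw hab) hl

lemma isHolderW1_moreauEnvelope_of_one_le (hl : 0 ≤ l) (hα : 1 ≤ α)
    (hm : ∀ ξ, (m : EReal) ≤ F ξ) (hF : ∃ ξ, F ξ ≠ ⊤) :
    IsHolderW1 (l * (α * Metric.diam (Set.univ : Set X) ^ (α - 1))) 1 (moreauEnvelope F l α) := by
  refine isHolderW1_moreauEnvelope hl hm hF fun a b w ha hb hw haD hab => ?_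
  rw [Real.rpow_one, mul_assoc, ← mul_add]
  exact mul_le_mul_of_nonneg_left (rpow_le_rpow_add_mul_of_one_le hα ha hb hw haD hab) hl

end MoreauEnvelope

theorem mainTheorem6 {X : Type*} [MetricSpace X] [CompactSpace X] [MeasurableSpace X]
    [BorelSpace X] (φ : ℝ → EReal) (hφ_proper : IsProperFn φ) (hφ_convex : IsConvexFn φ)
    (hφ_lsc : LowerSemicontinuous φ) (ν : ProbabilityMeasure X) (α : ℝ) (hα : 0 < α) :
    (∀ (μ : ProbabilityMeasure X) (l : ℝ), 0 < l →
      ∃ ξ : ProbabilityMeasure X,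
        moreauYosidaObjective φ l α μ ν ξ = moreauYosidaDivergence φ l α μ ν) ∧
    (∀ μ : ProbabilityMeasure X,
      fDivergence φ μ ν = (⨆ (l : ℝ) (_ : 0 < l), moreauYosidaDivergence φ l α μ ν) ∧
      Tendsto (fun l : ℝ => moreauYosidaDivergence φ l α μ ν) atTop
        (𝓝 (fDivergence φ μ ν))) ∧
    (φ 1 < ⊤ → ∀ l : ℝ, 0 < l →
      (α < 1 → IsHolderW1 l α (fun μ => moreauYosidaDivergence φ l α μ ν)) ∧
      (α = 1 → IsHolderW1 l 1 (fun μ => moreauYosidaDivergence φ l α μ ν)) ∧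
      (1 < α → ∃ C : ℝ, 0 ≤ C ∧
        IsHolderW1 C 1 (fun μ => moreauYosidaDivergence φ l α μ ν))) := by
  have hlsc := lowerSemicontinuous_fDivergence hφ_proper hφ_convex hφ_lsc ν
  obtain ⟨m, hm⟩ := exists_real_le_fDivergence hφ_proper hφ_convex hφ_lsc ν
  refine ⟨fun μ l hl => exists_add_mul_wasserstein1_rpow_eq_moreauEnvelope hlsc hl.le hα.le μ,
    fun μ => ⟨eq_iSup_moreauEnvelope hlsc hm hα μ, tendsto_moreauEnvelope hlsc hm hα μ⟩,
    fun hφ_one l hl => ?_⟩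
  have hfin : ∃ ξ, fDivergence φ ξ ν ≠ ⊤ := ⟨ν, (fDivergence_self φ ν).trans_ne hφ_one.ne⟩
  refine ⟨fun hα₁ => isHolderW1_moreauEnvelope_of_le_one hl.le hα.le hα₁.le hm hfin, ?_,
    fun hα₁ => ⟨_, ?_, isHolderW1_moreauEnvelope_of_one_le hl.le hα₁.le hm hfin⟩⟩
  · rintro rfl
    exact isHolderW1_moreauEnvelope_of_le_one hl.le hα.le le_rfl hm hfin
  · positivity
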